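/- **Setting.** Let $\mathcal G=\mathrm{SE}_3\times\mathbb R^6$ with product $(E,v)(E',v')=(EE',v+v')$, Lie algebra $\mathfrak g=\mathfrak{se}_3\times\mathbb R^6$, bracket $[(\xi_1,\xi_2),(\eta_1,\eta_2)]=(\xi_1\eta_1-\eta_1\xi_1,0)$, $G\eta:=(E\eta_1,\eta_2)$ for $G=(E,v)$, $\operatorname{Exp}(\eta)=(e^{\eta_1},\eta_2)$, and the left-invariant metric $\langle G\xi,G\eta\rangle_G=\operatorname{tr}(\xi_1^\top\eta_1)+\langle\xi_2,\eta_2\rangle$. Let $$\operatorname{mat}_{\mathfrak{se}}(u)=\begin{pmatrix}0&-u_3/\sqrt2&u_2/\sqrt2&u_4\\u_3/\sqrt2&0&-u_1/\sqrt2&u_5\\-u_2/\sqrt2&u_1/\sqrt2&0&u_6\\0&0&0&0\end{pmatrix},$$ $\operatorname{vec}_{\mathfrak{se}}=\operatorname{mat}_{\mathfrak{se}}^{-1}$, $\operatorname{mat}_{\mathfrak g}(u)=(\operatorname{mat}_{\mathfrak{se}}(u_{1:6}),u_{7:12})$, $\operatorname{vec}_{\mathfrak g}=\operatorname{mat}_{\mathfrak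 g}^{-1}$. The left-trivialized differential of a map $\psi$ on $\mathcal G$ with values in $\mathbb R^m$, at $G$, is the Jacobian at $u=0$ of $u\mapsto\psi(G\operatorname{Exp}(\operatorname{mat}_{\mathfrak g}u))$; for maps into $\mathfrak g$ one composes with $\operatorname{vec}_{\mathfrak g}$. Let $\operatorname{ad}(u)\in\mathbb R^{12\times12}$ be the matrix of $\eta\mapsto[\operatorname{mat}_{\mathfrak g}u,\eta]$ in the coordinates $\operatorname{vec}_{\mathfrak g}$. **The filter on $\mathcal G$.** Consider a state equation $\dot G=G(f(G)+\delta)$, with covariance $S$ of $\delta$, and observations $z_l=h(G(t_l))+\epsilon_l\in\mathbb R^m$ at times $t_1<t_2<\dots$, with covariance $Q_l$ of $\epsilon_l$. The continuous-discrete extended Kalman filter of Bourmaud et al. does the following in step $l$, starting from $G(t_{l-1})\in\mathcal G$ and the covariance matrix $P(t_{l-1})$. *Propagation*: on $[t_{l-1},t_l]$ solve $$\dot G=G\,f(G),$$ $$\dot P=JP+PJ^\top+S+\tfrac14\mathbb E\bigl(\operatorname{ad}(\varepsilon)S\operatorname{ad}(\varepsilon)^\top\bigr)+\tfrac1{12}\mathbb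 E\bigl(\operatorname{ad}(\varepsilon)^2\bigr)S+\tfrac1{12}S\,\mathbb E\bigl(\operatorname{ad}(\varepsilon)^2\bigr)^\top,\qquad\varepsilon\sim\mathcal N(0,P(t)),$$ with $G\in\mathcal G$ and $P$ positive semidefinite; call the values at $t_l$ $G^-$ and $P^-$. *Update*: $$K_l=P^-H_l^\top(H_lP^-H_l^\top+Q_l)^{-1},\quad m_l=K_lr_l,\quad G(t_l)=G^-\operatorname{Exp}(\operatorname{mat}_{\mathfrak g}m_l),\quad P(t_l)=\Phi(m_l)(\mathbb 1_{12}-K_lH_l)P^-\Phi(m_l)^\top.$$ Here $r_l=z_l-h(G^-)$, $H_l$ is the left-trivialized differential of $h$ at $G^-$, $\Phi(u)=\sum_{m\ge0}\frac{(-1)^m}{(m+1)!}\operatorname{ad}(u)^m$, and $J(t)=F(t)-\operatorname{ad}(\operatorname{vec}_{\mathfrak g}f(G(t)))+\frac1{12}C(S)$, where $F(t)$ is the left-trivialized differential of $f$ at $G(t)$ and $C(S)=\sum_{i,j}S_{ij}\operatorname{ad}(e_i)\operatorname{ad}(e_j)$. **The model.** Let $f(E,v)=(\operatorname{mat}_{\mathfrak{se}}(v),0)$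 (constant acceleration). For $k=1,\dots,n$ let $y_k=h_k(E,t)+\epsilon_k\in\mathbb R^2$, where $h_k(E,t)=\pi((E^{-1}g_k(t))_{1:3})$, $\pi(p)=p_3^{-1}(p_1,p_2)^\top$, and $g_k(t)=(d_k(t)x^k_1,d_k(t)x^k_2,d_k(t),1)^\top$ for a pixel $x^k\in\mathbb R^2$ with depth $d_k(t)$. The observations are aggregated: $z_l=\sum_ky_k(t_l)$, $h=\sum_kh_k$ and $Q_l\in\mathbb R^{2\times2}$. Let $S$ and all $Q_l$ be symmetric positive definite. Put $\kappa_k=\kappa_k(E)=e_3^\top E^{-1}g_k$. **Proposition.** The extended Kalman filter of Bourmaud et al. for this model is given by the above algorithm with the following explicit expressions. That is, for every finite number of steps, states and covariances form a run of that filter if and only if they satisfy the algorithm with these expressions, provided that $\kappa_k\neq0$ for all $k$ at each predicted state. 1. $r_l=\sum_{k=1}^n\bigl(y_k(t_l)-h_k(E^-,t_l)\bigr)$, where $G^-=(E^-,v^-)$. 2. $J(t)=F-\operatorname{ad}(\operatorname{vec}_{\mathfrak g}f(G(t)))+\tfrac1{12}C(S)$ with $$F=\begin{pmatrix}0&\mathbb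 1_6\\0&0\end{pmatrix},\qquad\operatorname{ad}(u)=\begin{pmatrix}\operatorname{ad}_{\mathfrak{se}}(u_{1:6})&0\\0&0\end{pmatrix},\qquad\operatorname{ad}_{\mathfrak{se}}(u)=\begin{pmatrix}\operatorname{mat}_{\mathfrak{so}}(u_{1:3})&0\\\operatorname{mat}_{\mathfrak{so}}(u_{4:6})&\operatorname{mat}_{\mathfrak{so}}(u_{1:3})\end{pmatrix},$$ where $\operatorname{mat}_{\mathfrak{so}}(u_{1:3})$ is the upper left $3\times3$ block of $\operatorname{mat}_{\mathfrak{se}}(u)$. If $S$ is diagonal, then $C(S)=\operatorname{diag}(\Xi,\Xi,0_{6\times6})$ with $\Xi=-\tfrac12\operatorname{diag}(S_{22}+S_{33},S_{11}+S_{33},S_{11}+S_{22})$. 3. $\Phi(u)=\operatorname{diag}(\Phi_{\mathrm{SE}_3}(u_{1:6}),\mathbb 1_6)$ with $\Phi_{\mathrm{SE}_3}(u)=\sum_{m\ge0}\frac{(-1)^m}{(m+1)!}\operatorname{ad}_{\mathfrak{se}}(u)^m$. 4. $$H_l=\sum_{k=1}^n\begin{pmatrix}\operatorname{vec}_{\mathfrak{se}}(\operatorname{Pr}(\rho_k^1))^\top&0_{1\times6}\\\operatorname{vec}_{\mathfrak{se}}(\operatorname{Pr}(\rho_k^2))^\top&0_{1\times6}\end{pmatrix},\qquad\rho_k^j=\bigl(\kappa_k^{-2}E^{-1}g_k\,(e_j^\top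 E^{-1}g_k)\,e_3^\top-\kappa_k^{-1}E^{-1}g_ke_j^\top\bigr)^\top,$$ evaluated at the predicted state $G^-$ and at $t_l$, where $\operatorname{Pr}(A)=\tfrac12\operatorname{diag}(1,1,1,0)\bigl(A\operatorname{diag}(1,1,1,2)-A^\top\operatorname{diag}(1,1,1,0)\bigr)$ is the projection onto $\mathfrak{se}_3$. This is the summed left-trivialized Riemannian gradient of the $h_k$: whenever $\kappa_k(E)\ne0$, the Riemannian gradient of the component $h_k^j$ at $G=(E,v)\in\mathcal G$ is $G(\operatorname{Pr}(\rho_k^j),0)$, and if $\kappa_k(E)\neq0$ for all $k$, the matrix $H_l$ formed at $G$ is the left-trivialized differential of $\sum_kh_k$ at $G$. -/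

import Mathlib

open Matrix Set MeasureTheory ProbabilityTheory
open scoped Nat

noncomputable section

namespace EgoMotion

/-! ### The Lie group `𝒢 = SE₃ × ℝ⁶` and its Lie algebra -/

/-- Real `4 × 4` matrices. -/
abbrev M4 := Matrix (Fin 4) (Fin 4) ℝ

/-- The ambient space `ℝ^{4×4} × ℝ⁶`; it contains both the group `𝒢` and its tangent spaces. -/
abbrev Amb := M4 × (Fin 6 → ℝ)

/-- The index set of the twelve coordinates of the Lie algebra, in two blocks of six. -/
abbrev Ix := Fin 6 ⊕ Fin 6

/-- Real `12 × 12` matrices, in four blocks of size `6 × 6`. -/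
abbrev M12 := Matrix Ix Ix ℝ

/-- The matrix with rotation part `R` and translation part `w`. -/
def rigid (R : Matrix (Fin 3) (Fin 3) ℝ) (w : Fin 3 → ℝ) : M4 :=
  !![R 0 0, R 0 1, R 0 2, w 0;
     R 1 0, R 1 1, R 1 2, w 1;
     R 2 0, R 2 1, R 2 2, w 2;
     0, 0, 0, 1]

/-- The special Euclidean group `SE₃`. -/
def SE3 : Set M4 :=
  {E | ∃ R ∈ Matrix.specialOrthogonalGroup (Fin 3) ℝ, ∃ w : Fin 3 → ℝ, E = rigid R w}

/-- The Lie algebra `𝔰𝔢₃`: skew-symmetric upper left `3 × 3` block, vanishing last row. -/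
def se3 : Set M4 :=
  {A | (∀ i j : Fin 3, A i.castSucc j.castSucc = -A j.castSucc i.castSucc) ∧ ∀ j, A 3 j = 0}

/-- The group `𝒢 = SE₃ × ℝ⁶`. -/
def grp : Set Amb := {G | G.1 ∈ SE3}

/-- The Lie algebra `𝔤 = 𝔰𝔢₃ × ℝ⁶`. -/
def lieAlg : Set Amb := {ξ | ξ.1 ∈ se3}

/-- The group law of `𝒢`: matrix product in `SE₃`, addition in `ℝ⁶`. -/
def gmul (G G' : Amb) : Amb := (G.1 * G'.1, G.2 + G'.2)

/-- The tangent map of the left translation by `G` at the identity, `G η = (E η₁, η₂)`. -/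
def tmap (G ξ : Amb) : Amb := (G.1 * ξ.1, ξ.2)

/-- The exponential map of `𝒢`. -/
def gexp (ξ : Amb) : Amb := (NormedSpace.exp ξ.1, ξ.2)

/-- The Lie bracket of `𝔤`: matrix commutator on `𝔰𝔢₃`, zero on `ℝ⁶`. -/
def bracket (ξ η : Amb) : Amb := (ξ.1 * η.1 - η.1 * ξ.1, 0)

/-- `mat_𝔰𝔢 : ℝ⁶ → 𝔰𝔢₃`. -/
def matSe (u : Fin 6 → ℝ) : M4 :=
  !![0, -(u 2 / √2), u 1 / √2, u 3;
     u 2 / √2, 0, -(u 0 / √2), u 4;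
     -(u 1 / √2), u 0 / √2, 0, u 5;
     0, 0, 0, 0]

/-- `vec_𝔰𝔢`, the inverse of `mat_𝔰𝔢` on `𝔰𝔢₃`. -/
def vecSe (A : M4) : Fin 6 → ℝ := ![√2 * A 2 1, √2 * A 0 2, √2 * A 1 0, A 0 3, A 1 3, A 2 3]

/-- `mat_𝔤 : ℝ¹² → 𝔤`. -/
def matG (u : Ix → ℝ) : Amb := (matSe (fun i => u (Sum.inl i)), fun i => u (Sum.inr i))

/-- `vec_𝔤`, the inverse of `mat_𝔤` on `𝔤`. -/
def vecG (ξ : Amb) : Ix → ℝ := Sum.elim (vecSe ξ.1) ξ.2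

theorem vecSe_matSe (u : Fin 6 → ℝ) : vecSe (matSe u) = u := by
  have h : (√2 : ℝ) ≠ 0 := by positivity
  funext i
  fin_cases i <;> simp [vecSe, matSe] <;> field_simp

theorem vecG_matG (u : Ix → ℝ) : vecG (matG u) = u := by
  funext i
  rcases i with i | i <;> simp [vecG, matG, vecSe_matSe]

/-- The left-invariant Riemannian metric
`⟨ξ, η⟩_G = tr((E⁻¹ξ₁)ᵀ (E⁻¹η₁)) + ⟨ξ₂, η₂⟩` on `𝒢`, for `G = (E, v)`. -/
def metric (G ξ η : Amb) : ℝ :=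
  ((G.1⁻¹ * ξ.1)ᵀ * (G.1⁻¹ * η.1)).trace + ξ.2 ⬝ᵥ η.2

/-- `γ` is the Riemannian gradient of `ψ : 𝒢 → ℝ` at `G`: a tangent vector at `G` with
`dψ(G)[Gη] = ⟨γ, Gη⟩_G` for all `η ∈ 𝔤`. The differential is taken in the chart
`u ↦ G Exp(mat_𝔤 u)`, and `η = mat_𝔤 u`. -/
def IsRiemannianGradient (ψ : Amb → ℝ) (G γ : Amb) : Prop :=
  (∃ η ∈ lieAlg, γ = tmap G η) ∧
  ∃ D : (Ix → ℝ) →L[ℝ] ℝ,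
    HasFDerivAt (fun u : Ix → ℝ => ψ (gmul G (gexp (matG u)))) D 0 ∧
    ∀ u, D u = metric G γ (tmap G (matG u))

/-- `A` is the matrix of the left-trivialized differential at `G` of a vector-valued map `ψ` on
`𝒢`: the Jacobian at `0` of `u ↦ ψ(G Exp(mat_𝔤 u))`. -/
def IsLeftDifferential {ι : Type} [Fintype ι] (ψ : Amb → ι → ℝ) (G : Amb) (A : Matrix ι Ix ℝ) :
    Prop :=
  HasFDerivAt (fun u : Ix → ℝ => ψ (gmul G (gexp (matG u))))
    (LinearMap.toContinuousLinearMap A.mulVecLin) 0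

/-- The matrix, in the coordinates `vec_𝔤`, of the adjoint `ad_𝔤(ξ) η = [ξ, η]`, `ξ = mat_𝔤 u`. -/
def adG (u : Ix → ℝ) : M12 :=
  Matrix.of fun i j => vecG (bracket (matG u) (matG (Pi.single j 1))) i

/-- The power series `∑ₘ (-1)ᵐ / (m+1)! Aᵐ`. -/
def phiSeries {ι : Type} [Fintype ι] [DecidableEq ι] (A : Matrix ι ι ℝ) : Matrix ι ι ℝ :=
  ∑' m : ℕ, ((-1 : ℝ) ^ m / ((m + 1)! : ℝ)) • A ^ m

/-- The right Jacobian `Φ` of the exponential map of `𝒢`, in coordinates. -/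
def phiG (u : Ix → ℝ) : M12 := phiSeries (adG u)

/-- The second-order correction `C(S) = ∑ᵢⱼ Sᵢⱼ ad(eᵢ) ad(eⱼ)`, that is the expectation of
`ad(ν)²` for Lie algebra noise `ν` with mean zero and covariance `S`. -/
def corr (ad : (Ix → ℝ) → M12) (S : M12) : M12 :=
  ∑ i, ∑ j, S i j • (ad (Pi.single i 1) * ad (Pi.single j 1))

/-! ### The algorithm -/

/-- Entrywise expectation of `ψ(ε)` for a centred Gaussian vector `ε` with covariance `P`. -/
def gaussMean (P : M12) (ψ : (Ix → ℝ) → M12) : M12 :=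
  Matrix.of fun i j =>
    ∫ ε : EuclideanSpace ℝ Ix, ψ (WithLp.ofLp ε) i j ∂(multivariateGaussian 0 P)

/-- Right-hand side of the differential equation of the covariance; `ε` is the Gaussian
left-invariant error, with covariance `P`. -/
def covRhs (ad : (Ix → ℝ) → M12) (J S P : M12) : M12 :=
  J * P + P * Jᵀ + S
    + (1 / 4 : ℝ) • gaussMean P (fun ε => ad ε * S * (ad ε)ᵀ)
    + (1 / 12 : ℝ) • (gaussMean P (fun ε => ad ε ^ 2) * S)
    + (1 / 12 : ℝ) • (S * (gaussMean P (fun ε => ad ε ^ 2))ᵀ)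

/-- The gain `K = P Hᵀ (H P Hᵀ + Q)⁻¹`. -/
def gain {m : ℕ} (P : M12) (H : Matrix (Fin m) Ix ℝ) (Q : Matrix (Fin m) (Fin m) ℝ) :
    Matrix Ix (Fin m) ℝ :=
  P * Hᵀ * (H * P * Hᵀ + Q)⁻¹

/-- One step of the algorithm: propagation on `[a, b]` and update at time `b`. The inputs are the
state `G₀` and the covariance `P₀` at time `a`; the functions `G`, `P` solve the propagation
equations on `[a, b]`, so that `G b`, `P b` are the predicted state and covariance; `G₁`, `P₁` are
the updated ones. The parameters are the drift `f`, the matrices `ad`, `Φ`, the function `J`, the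
noise covariances `S`, `Q`, the residual `r` as a function of the predicted state, and the
observation matrix `H` as a function of the predicted state. -/
structure AlgorithmStep {m : ℕ} (f : Amb → Amb) (ad Φ : (Ix → ℝ) → M12) (J : ℝ → M12) (S : M12)
    (Q : Matrix (Fin m) (Fin m) ℝ) (r : Amb → Fin m → ℝ) (H : Matrix (Fin m) Ix ℝ)
    (a b : ℝ) (G₀ : Amb) (P₀ : M12) (G : ℝ → Amb) (P : ℝ → M12) (G₁ : Amb) (P₁ : M12) : Prop where
  state_init : G a = G₀
  cov_init : P a = P₀
  state_mem : ∀ t ∈ Icc a b, G t ∈ grp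
  cov_mem : ∀ t ∈ Icc a b, (P t).PosSemidef
  state_ode : ∀ t ∈ Icc a b, HasDerivWithinAt G (tmap (G t) (f (G t))) (Icc a b) t
  cov_ode : ∀ t ∈ Icc a b, HasDerivWithinAt P (covRhs ad (J t) S (P t)) (Icc a b) t
  state_update :
    G₁ = gmul (G b) (gexp (matG (gain (P b) H Q *ᵥ r (G b))))
  cov_update :
    P₁ = Φ (gain (P b) H Q *ᵥ r (G b)) * (1 - gain (P b) H Q * H) * P b
      * (Φ (gain (P b) H Q *ᵥ r (G b)))ᵀ

/-- `J` is the linearized drift matrix `F - ad_𝔤(f(G)) + C(S)/12` at the state `G`, where `F` is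
the left-trivialized differential of the drift `f : 𝒢 → 𝔤` at `G`. -/
def IsDriftMatrix (f : Amb → Amb) (S : M12) (G : Amb) (J : M12) : Prop :=
  ∃ F : M12, IsLeftDifferential (fun X => vecG (f X)) G F ∧
    J = F - adG (vecG (f G)) + (1 / 12 : ℝ) • corr adG S

/-- One step of the continuous-discrete extended Kalman filter on the Lie group `𝒢`, for a general
state equation `Ġ = G (f(G) + δ)` with noise covariance `S`, and a general observation
`z = h(G(b)) + ε` in `ℝᵐ` at time `b` with noise covariance `Q`. -/
def LieEKFStep {m : ℕ} (f : Amb → Amb) (h : Amb → Fin m → ℝ) (z : Fin m → ℝ) (S : M12)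
    (Q : Matrix (Fin m) (Fin m) ℝ) (a b : ℝ) (G₀ : Amb) (P₀ : M12) (G : ℝ → Amb) (P : ℝ → M12)
    (G₁ : Amb) (P₁ : M12) : Prop :=
  ∃ (J : ℝ → M12) (H : Matrix (Fin m) Ix ℝ),
    (∀ t ∈ Icc a b, IsDriftMatrix f S (G t) (J t)) ∧
    IsLeftDifferential h (G b) H ∧
    AlgorithmStep f adG phiG J S Q (fun X => z - h X) H a b G₀ P₀ G P G₁ P₁

/-! ### The constant-acceleration model with perspective observations -/

/-- The drift `f(E, v) = (mat_𝔰𝔢 v, 0)`. -/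
def drift (G : Amb) : Amb := (matSe G.2, 0)

/-- The perspective projection `π : ℝ³ → ℝ²`. -/
def persp (p : Fin 3 → ℝ) : Fin 2 → ℝ := (p 2)⁻¹ • ![p 0, p 1]

/-- The data vector `(d x₁, d x₂, d, 1)` of a pixel `x` with depth `d`. -/
def dataVec (x : Fin 2 → ℝ) (d : ℝ) : Fin 4 → ℝ := ![d * x 0, d * x 1, d, 1]

/-- The observation function `h(E) = π((E⁻¹ g)_{1:3})`. -/
def obs (g : Fin 4 → ℝ) (E : M4) : Fin 2 → ℝ := persp (fun i => (E⁻¹ *ᵥ g) i.castSucc)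

/-- `κ = e₃ᵀ E⁻¹ g`. -/
def kappa (g : Fin 4 → ℝ) (E : M4) : ℝ := (E⁻¹ *ᵥ g) 2

/-- The projection `Pr : ℝ^{4×4} → 𝔰𝔢₃`. -/
def prSe (A : M4) : M4 :=
  (1 / 2 : ℝ) • (diagonal ![1, 1, 1, 0] *
    (A * diagonal ![1, 1, 1, 2] - Aᵀ * diagonal ![1, 1, 1, 0]))

/-- `ρʲ = (κ⁻² E⁻¹ g (eⱼᵀ E⁻¹ g) e₃ᵀ - κ⁻¹ E⁻¹ g eⱼᵀ)ᵀ`, `j = 1, 2`. -/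
def rho (g : Fin 4 → ℝ) (E : M4) (j : Fin 2) : M4 :=
  ((kappa g E ^ 2)⁻¹ • (E⁻¹ *ᵥ g) (Fin.castLE (by omega) j) •
      vecMulVec (E⁻¹ *ᵥ g) (Pi.single 2 1)
    - (kappa g E)⁻¹ • vecMulVec (E⁻¹ *ᵥ g) (Pi.single (Fin.castLE (by omega) j) 1))ᵀ

/-- The explicit observation matrix `H_l`: row `j` is `∑ₖ (vec_𝔰𝔢(Pr(ρₖʲ))ᵀ, 0)`. -/
def obsMatrix {n : ℕ} (g : Fin n → Fin 4 → ℝ) (E : M4) : Matrix (Fin 2) Ix ℝ :=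
  ∑ k, Matrix.of fun j => Sum.elim (vecSe (prSe (rho (g k) E j))) 0

/-- `mat_𝔰𝔬`: the upper left `3 × 3` block of `mat_𝔰𝔢`. -/
def matSo (w : Fin 3 → ℝ) : Matrix (Fin 3) (Fin 3) ℝ :=
  !![0, -(w 2 / √2), w 1 / √2;
     w 2 / √2, 0, -(w 0 / √2);
     -(w 1 / √2), w 0 / √2, 0]

/-- The explicit adjoint matrix on `𝔰𝔢₃`, with blocks
`(mat_𝔰𝔬 u_{1:3}, 0; mat_𝔰𝔬 u_{4:6}, mat_𝔰𝔬 u_{1:3})`. -/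
def adSeVec (u : Fin 6 → ℝ) : Matrix (Fin 6) (Fin 6) ℝ :=
  (fromBlocks (matSo ![u 0, u 1, u 2]) 0 (matSo ![u 3, u 4, u 5])
    (matSo ![u 0, u 1, u 2])).submatrix
      (finSumFinEquiv (m := 3) (n := 3)).symm (finSumFinEquiv (m := 3) (n := 3)).symm

/-- The explicit adjoint matrix on `𝔤`. -/
def adGVec (u : Ix → ℝ) : M12 := fromBlocks (adSeVec (fun i => u (Sum.inl i))) 0 0 0

/-- The explicit form of `Φ`: the block diagonal matrix with blocks `Φ_{SE₃}(u_{1:6})` and `1`. -/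
def phiVec (u : Ix → ℝ) : M12 :=
  fromBlocks (phiSeries (adSeVec (fun i => u (Sum.inl i)))) 0 0 1

/-- The matrix `F` with blocks `(0, 1; 0, 0)`. -/
def driftDiff : M12 := fromBlocks 0 1 0 0

/-- The explicit function `J = F - ad_𝔤(f(G)) + C(S)/12`. -/
def driftMatrix (S : M12) (G : Amb) : M12 :=
  driftDiff - adGVec (vecG (drift G)) + (1 / 12 : ℝ) • corr adGVec S

/-- The explicit form of `C(S)` for the diagonal matrix `S` with entries `s`: the upper left block
is `diag(Ξ, Ξ)` with `Ξ = -½ diag(s₂ + s₃, s₁ + s₃, s₁ + s₂)`, the other blocks vanish. -/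
def corrDiag (s : Ix → ℝ) : M12 :=
  fromBlocks
    (diagonal ![-(s (.inl 1) + s (.inl 2)) / 2, -(s (.inl 0) + s (.inl 2)) / 2,
      -(s (.inl 0) + s (.inl 1)) / 2, -(s (.inl 1) + s (.inl 2)) / 2,
      -(s (.inl 0) + s (.inl 2)) / 2, -(s (.inl 0) + s (.inl 1)) / 2]) 0 0 0

end EgoMotion

end

open EgoMotion

namespace EgoMotion

/-! A filter step quantifies existentially over the drift matrix and the observation matrix, but
each is pinned down by a derivative, and derivatives are unique. So it suffices to exhibit one
left-trivialized differential of the drift and one of the observation, and to identify the adjoint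
and `Φ`. The equivalence of the two algorithms then holds step by step
(`lieEKFStep_iff_algorithmStep`).

In the chart `u ↦ G Exp(mat u)` the drift is affine. The adjoint is a commutator computed in
coordinates, and `Φ` splits along its block structure. For the observation, `(E exp A)⁻¹ g = exp(-A)
(E⁻¹ g)`, and `exp` has derivative the identity at `0`, so with `q = E⁻¹ g` each coordinate has
derivative `A ↦ -(A q)ᵢ`. The quotient rule, valid when `κ ≠ 0`, gives `A ↦ tr(ρᵀ A)`
(`hasFDerivAt_obs`). Replacing `ρ` by its orthogonal projection `Pr ρ` does not change this
functional on `𝔰𝔢₃`, which yields both the Riemannian gradient and the rows of `H`. -/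

/-- `mat_𝔰𝔢` as a linear map. -/
noncomputable def matSeLin : (Fin 6 → ℝ) →ₗ[ℝ] M4 where
  toFun := matSe
  map_add' u v := by
    ext i j
    fin_cases i <;> fin_cases j <;> simp [matSe] <;> ring
  map_smul' c u := by
    ext i j
    fin_cases i <;> fin_cases j <;> simp [matSe] <;> ring

theorem prSe_mem_se3 (A : M4) : prSe A ∈ se3 := by
  refine ⟨fun i j => ?_, fun j => ?_⟩
  · fin_cases i <;> fin_cases j <;>
      simp [prSe, Matrix.diagonal_mul, Matrix.mul_diagonal] <;> ring
  · fin_cases j <;> simp [prSe, Matrix.diagonal_mul, Matrix.mul_diagonal]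

theorem isUnit_det_of_mem_SE3 {E : M4} (hE : E ∈ SE3) : IsUnit E.det := by
  obtain ⟨R, hR, w, rfl⟩ := hE
  have h : R.det = 1 := (Matrix.mem_specialOrthogonalGroup_iff.1 hR).2
  have h' : (rigid R w).det = R.det := by
    simp [Matrix.det_succ_row_zero, Fin.sum_univ_succ, rigid, Fin.succAbove]
  rw [h', h]
  exact isUnit_one

/-- `Pr` is the orthogonal projection onto `𝔰𝔢₃` for the trace inner product. -/
theorem trace_transpose_mul_prSe (A : M4) (u : Fin 6 → ℝ) :
    ((prSe A)ᵀ * matSe u).trace = (Aᵀ * matSe u).trace := by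
  simp [Matrix.trace, Matrix.mul_apply, Fin.sum_univ_four, prSe, matSe]
  ring

/-- In the coordinates `vec_𝔰𝔢` the trace inner product is the Euclidean one. -/
theorem vecSe_prSe_dotProduct (A : M4) (u : Fin 6 → ℝ) :
    vecSe (prSe A) ⬝ᵥ u = (Aᵀ * matSe u).trace := by
  have h2 : (√2 : ℝ) ≠ 0 := by positivity
  have h3 : (√2 : ℝ) ^ 2 = 2 := Real.sq_sqrt (by norm_num)
  simp [Matrix.trace, Matrix.mul_apply, Fin.sum_univ_four, prSe, matSe, dotProduct,
    Fin.sum_univ_six, vecSe]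
  field_simp
  linear_combination
    ((A 2 1 - A 1 2) * u 0 + (A 0 2 - A 2 0) * u 1 + (A 1 0 - A 0 1) * u 2) * h3

/-- Left invariance: `E⁻¹` cancels `E`. This is where membership in the group is needed, for
invertibility of `E`. -/
theorem metric_tmap {G : Amb} (hG : G ∈ grp) (ξ η : Amb) :
    metric G (tmap G ξ) (tmap G η) = (ξ.1ᵀ * η.1).trace + ξ.2 ⬝ᵥ η.2 := by
  have h := isUnit_det_of_mem_SE3 hG
  simp [metric, tmap, Matrix.nonsing_inv_mul_cancel_left _ _ h]

/-! ### Drift and adjoint in coordinates -/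

theorem vecG_drift (G : Amb) : vecG (drift G) = Sum.elim G.2 0 := by
  simp [vecG, drift, vecSe_matSe]

theorem isLeftDifferential_drift (G : Amb) :
    IsLeftDifferential (fun X => vecG (drift X)) G driftDiff := by
  have h : (fun u : Ix → ℝ => vecG (drift (gmul G (gexp (matG u)))))
      = fun u => Sum.elim G.2 0 + LinearMap.toContinuousLinearMap driftDiff.mulVecLin u := by
    funext u i
    rcases i with i | i <;>
      simp [vecG_drift, gmul, gexp, matG, driftDiff, Matrix.fromBlocks_mulVec, Function.comp_def]
  unfold IsLeftDifferential
  rw [h]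
  exact (ContinuousLinearMap.hasFDerivAt _).const_add _

/-- With the `1/√2` scaling the rotational bracket is `u × v / √2`. Antisymmetry of the cross
product turns `-mat_𝔰𝔬(v_{1:3}) u_{4:6}` into the lower left block acting on `v_{1:3}`. -/
theorem vecSe_commutator (u v : Fin 6 → ℝ) :
    vecSe (matSe u * matSe v - matSe v * matSe u) = adSeVec u *ᵥ v := by
  have h2 : (√2 : ℝ) ≠ 0 := by positivity
  have h3 : (√2 : ℝ) ^ 2 = 2 := Real.sq_sqrt (by norm_num)
  funext i
  fin_cases i <;>
    simp [vecSe, matSe, adSeVec, matSo, Matrix.mulVec, dotProduct, Fin.sum_univ_six,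
      finSumFinEquiv, Fin.addCases] <;>
    field_simp <;> ring

theorem adG_eq_adGVec (u : Ix → ℝ) : adG u = adGVec u := by
  ext i j
  rcases i with i | i
  · simp only [adG, bracket, matG, vecG, vecSe_commutator, adGVec, of_apply, Sum.elim_inl]
    rcases j with j | j
    · have h : (fun i : Fin 6 => (Pi.single (Sum.inl j) 1 : Ix → ℝ) (Sum.inl i))
          = Pi.single j 1 := by
        funext i
        simp [Pi.single_apply]
      simp [h]
    · have h : (fun i : Fin 6 => (Pi.single (Sum.inr j) 1 : Ix → ℝ) (Sum.inl i)) = 0 := by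
        funext i
        simp
      rw [h, mulVec_zero]
      simp
  · rcases j with j | j <;> simp [adG, adGVec, vecG, bracket]

/-! ### The series for `Φ` and the derivative of `exp` -/

section Series

attribute [local instance] Matrix.linftyOpNormedRing Matrix.linftyOpNormedAlgebra

theorem summable_phiSeries {ι : Type} [Fintype ι] [DecidableEq ι] (A : Matrix ι ι ℝ) :
    Summable fun m : ℕ => ((-1 : ℝ) ^ m / ((m + 1)! : ℝ)) • A ^ m := by
  refine Summable.of_norm_bounded_eventually_nat
    (Real.summable_pow_div_factorial ‖A‖) ?_
  -- The bound `‖A ^ m‖ ≤ ‖A‖ ^ m` is used only for `m > 0`, which avoids any condition on `‖1‖`.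
  filter_upwards [Filter.eventually_gt_atTop 0] with m hm
  rw [norm_smul, norm_div, norm_pow, norm_neg, norm_one, one_pow, Real.norm_natCast,
    one_div_mul_eq_div]
  gcongr
  · exact norm_pow_le' A hm
  · omega

theorem hasFDerivAt_exp_neg_matSe (q : Fin 4 → ℝ) (i : Fin 4) :
    HasFDerivAt
      (fun u : Ix → ℝ => (NormedSpace.exp (-matSe fun i => u (Sum.inl i)) *ᵥ q) i)
      (LinearMap.toContinuousLinearMap
        (-(LinearMap.proj i ∘ₗ (Matrix.mulVecBilin ℝ ℝ).flip q ∘ₗ matSeLin ∘ₗ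
          LinearMap.funLeft ℝ ℝ (Sum.inl : Fin 6 → Ix)))) 0 := by
  let L : (Ix → ℝ) →L[ℝ] M4 := LinearMap.toContinuousLinearMap
    (-(matSeLin ∘ₗ LinearMap.funLeft ℝ ℝ (Sum.inl : Fin 6 → Ix)))
  let T : M4 →L[ℝ] ℝ := LinearMap.toContinuousLinearMap
    (LinearMap.proj i ∘ₗ (Matrix.mulVecBilin ℝ ℝ).flip q)
  have h0 : HasFDerivAt (NormedSpace.exp : M4 → M4) (1 : M4 →L[ℝ] M4) (L 0) := by
    rw [map_zero]
    exact hasFDerivAt_exp_zero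
  have h := T.hasFDerivAt.comp (0 : Ix → ℝ) (h0.comp (0 : Ix → ℝ) L.hasFDerivAt)
  refine h.congr_fderiv ?_
  ext u
  change T (L u) = _
  simp [L, T]

end Series

/-- The series is transported along the continuous additive map forming block diagonal matrices. In
the zero block only the term `m = 0` survives, which gives the identity. -/
theorem phiSeries_fromBlocks (A : Matrix (Fin 6) (Fin 6) ℝ) :
    phiSeries (fromBlocks A 0 0 0 : M12) = fromBlocks (phiSeries A) 0 0 1 := by
  have hpow (m : ℕ) : (fromBlocks A 0 0 0 : M12) ^ m = fromBlocks (A ^ m) 0 0 (0 ^ m) := by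
    induction m with
    | zero => simp
    | succ m ih => rw [pow_succ, ih, fromBlocks_multiply]; simp [pow_succ]
  have h1 : HasSum (fun m : ℕ =>
      ((-1 : ℝ) ^ m / ((m + 1)! : ℝ)) • (0 : Matrix (Fin 6) (Fin 6) ℝ) ^ m) 1 := by
    convert hasSum_ite_eq 0 (1 : Matrix (Fin 6) (Fin 6) ℝ) using 2 with m
    rcases m with _ | m <;> simp
  have hc : Continuous fun p : Matrix (Fin 6) (Fin 6) ℝ × Matrix (Fin 6) (Fin 6) ℝ =>
      (fromBlocks p.1 0 0 p.2 : M12) :=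
    continuous_fst.matrix_fromBlocks continuous_const continuous_const continuous_snd
  have h := (summable_phiSeries A).hasSum.prodMk h1
  let B : Matrix (Fin 6) (Fin 6) ℝ × Matrix (Fin 6) (Fin 6) ℝ →+ M12 :=
    { toFun := fun p => fromBlocks p.1 0 0 p.2
      map_zero' := by simp
      map_add' := fun p q => by simp [fromBlocks_add] }
  have h' := h.map B hc
  refine Eq.trans ?_ h'.tsum_eq
  unfold phiSeries
  congr 1
  funext m
  simp [B, hpow, fromBlocks_smul]

theorem phiG_eq_phiVec (u : Ix → ℝ) : phiG u = phiVec u := by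
  rw [phiG, adG_eq_adGVec, adGVec, phiSeries_fromBlocks, phiVec]

theorem IsLeftDifferential.unique {ι : Type} [Fintype ι] {ψ : Amb → ι → ℝ} {G : Amb}
    {A B : Matrix ι Ix ℝ} (hA : IsLeftDifferential ψ G A) (hB : IsLeftDifferential ψ G B) :
    A = B := by
  have h := HasFDerivAt.unique hA hB
  apply Matrix.toLin'.injective
  exact LinearMap.toContinuousLinearMap.injective h

theorem isDriftMatrix_iff (S : M12) (G : Amb) (J : M12) :
    IsDriftMatrix drift S G J ↔ J = driftMatrix S G := by
  have had : adG = adGVec := funext adG_eq_adGVec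
  unfold IsDriftMatrix driftMatrix
  rw [had]
  refine ⟨?_, fun h => ⟨_, isLeftDifferential_drift G, h⟩⟩
  rintro ⟨F, hF, rfl⟩
  rw [hF.unique (isLeftDifferential_drift G)]

/-! ### The correction `C(S)` for diagonal `S` -/

theorem adSeVec_mul_self (u : Fin 6 → ℝ) :
    adSeVec u * adSeVec u =
      (fromBlocks (matSo ![u 0, u 1, u 2] * matSo ![u 0, u 1, u 2]) 0
        (matSo ![u 3, u 4, u 5] * matSo ![u 0, u 1, u 2]
          + matSo ![u 0, u 1, u 2] * matSo ![u 3, u 4, u 5])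
        (matSo ![u 0, u 1, u 2] * matSo ![u 0, u 1, u 2])).submatrix
      (finSumFinEquiv (m := 3) (n := 3)).symm (finSumFinEquiv (m := 3) (n := 3)).symm := by
  simp [adSeVec, fromBlocks_multiply]

/-- The identity `ŵ² = w wᵀ - |w|² 1` for the cross product matrix; the factor `1/2` is the square
of the `1/√2` scaling. -/
theorem matSo_mul_self (w : Fin 3 → ℝ) :
    matSo w * matSo w = (1 / 2 : ℝ) • (vecMulVec w w - (w ⬝ᵥ w) • 1) := by
  have h2 : (√2 : ℝ) ≠ 0 := by positivity
  have h3 : (√2 : ℝ) ^ 2 = 2 := Real.sq_sqrt (by norm_num)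
  ext i j
  fin_cases i <;> fin_cases j <;>
    simp [matSo, Matrix.mul_apply, Fin.sum_univ_three, vecMulVec_apply, dotProduct] <;>
    field_simp <;> rw [h3] <;> ring

theorem adSeVec_single_mul_self (i : Fin 6) :
    adSeVec (Pi.single i 1) * adSeVec (Pi.single i 1) =
      diagonal (![![0, -1/2, -1/2, 0, -1/2, -1/2], ![-1/2, 0, -1/2, -1/2, 0, -1/2],
        ![-1/2, -1/2, 0, -1/2, -1/2, 0], 0, 0, 0] i) := by
  have hz : matSo ![0, 0, 0] = 0 := by
    ext i j
    fin_cases i <;> fin_cases j <;> simp [matSo]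
  have h0 : matSo ![1, 0, 0] * matSo ![1, 0, 0] = diagonal ![0, -1/2, -1/2] := by
    rw [matSo_mul_self]
    ext i j
    fin_cases i <;> fin_cases j <;> simp [dotProduct, Fin.sum_univ_three] <;> norm_num
  have h1 : matSo ![0, 1, 0] * matSo ![0, 1, 0] = diagonal ![-1/2, 0, -1/2] := by
    rw [matSo_mul_self]
    ext i j
    fin_cases i <;> fin_cases j <;> simp [dotProduct, Fin.sum_univ_three] <;> norm_num
  have h2 : matSo ![0, 0, 1] * matSo ![0, 0, 1] = diagonal ![-1/2, -1/2, 0] := by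
    rw [matSo_mul_self]
    ext i j
    fin_cases i <;> fin_cases j <;> simp [dotProduct, Fin.sum_univ_three] <;> norm_num
  rw [adSeVec_mul_self]
  fin_cases i
  · simp [hz, h0]
    exact fun k => by fin_cases k <;> rfl
  · simp [hz, h1]
    exact fun k => by fin_cases k <;> rfl
  · simp [hz, h2]
    exact fun k => by fin_cases k <;> rfl
  all_goals simp [hz]

/-- Only the squares `ad(eᵢ)²` remain. The `ℝ⁶` directions are central and the translations have
square zero, so just the three rotations contribute. -/
theorem corr_diagonal (s : Ix → ℝ) : corr adGVec (diagonal s) = corrDiag s := by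
  have h : corr adGVec (diagonal s) =
      ∑ i, s i • (adGVec (Pi.single i 1) * adGVec (Pi.single i 1)) := by
    unfold corr
    refine Finset.sum_congr rfl fun i _ => ?_
    rw [Finset.sum_eq_single i] <;> simp +contextual [eq_comm]
  have hsq (i : Fin 6) : adGVec (Pi.single (Sum.inl i) 1) * adGVec (Pi.single (Sum.inl i) 1)
      = fromBlocks (adSeVec (Pi.single i 1) * adSeVec (Pi.single i 1)) 0 0 0 := by
    have hi : (fun k : Fin 6 => (Pi.single (Sum.inl i) 1 : Ix → ℝ) (Sum.inl k))
        = Pi.single i 1 := by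
      funext k
      simp [Pi.single_apply]
    simp [adGVec, fromBlocks_multiply, hi]
  have hsq' (i : Fin 6) : adGVec (Pi.single (Sum.inr i) 1) = 0 := by
    have hz : adSeVec (fun _ => 0) = 0 := by
      have hz' : matSo ![0, 0, 0] = 0 := by
        ext i j
        fin_cases i <;> fin_cases j <;> simp [matSo]
      simp [adSeVec, hz']
    simp [adGVec, hz]
  rw [h, Fintype.sum_sum_type]
  simp only [hsq, hsq', adSeVec_single_mul_self, Matrix.mul_zero, smul_zero,
    Finset.sum_const_zero, add_zero, corrDiag, Fin.sum_univ_six, fromBlocks_smul, fromBlocks_add]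
  congr 1
  simp only [← diagonal_smul, diagonal_add]
  congr 1
  funext k
  fin_cases k <;> simp <;> ring

/-! ### Derivatives of the observations -/

theorem obs_gmul_gexp (g : Fin 4 → ℝ) (G : Amb) (u : Ix → ℝ) (j : Fin 2) :
    obs g (gmul G (gexp (matG u))).1 j =
      ((NormedSpace.exp (-matSe fun i => u (Sum.inl i)) *ᵥ (G.1⁻¹ *ᵥ g)) 2)⁻¹ *
        (NormedSpace.exp (-matSe fun i => u (Sum.inl i)) *ᵥ (G.1⁻¹ *ᵥ g))
          (Fin.castLE (by omega) j) := by
  simp only [obs, persp, gmul, gexp, matG, Matrix.mul_inv_rev, Matrix.exp_neg, mulVec_mulVec]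
  fin_cases j <;> rfl

theorem hasFDerivAt_obs (g : Fin 4 → ℝ) (G : Amb) (j : Fin 2) (h : kappa g G.1 ≠ 0) :
    ∃ D : (Ix → ℝ) →L[ℝ] ℝ,
      HasFDerivAt (fun u : Ix → ℝ => obs g (gmul G (gexp (matG u))).1 j) D 0 ∧
      ∀ u, D u = ((rho g G.1 j)ᵀ * matSe fun i => u (Sum.inl i)).trace := by
  have h0 : (NormedSpace.exp (-matSe fun i => (0 : Ix → ℝ) (Sum.inl i)) *ᵥ (G.1⁻¹ *ᵥ g))
      = G.1⁻¹ *ᵥ g := by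
    have hz : matSe (fun i => (0 : Ix → ℝ) (Sum.inl i)) = 0 := matSeLin.map_zero
    rw [hz, neg_zero, NormedSpace.exp_zero, one_mulVec]
  have h1 := hasFDerivAt_exp_neg_matSe (G.1⁻¹ *ᵥ g) 2
  have h2 := hasFDerivAt_exp_neg_matSe (G.1⁻¹ *ᵥ g) (Fin.castLE (by omega) j)
  have hk : (NormedSpace.exp (-matSe fun i => (0 : Ix → ℝ) (Sum.inl i)) *ᵥ (G.1⁻¹ *ᵥ g)) 2 ≠ 0 := by
    rw [h0]; exact h
  have h3 := (hasFDerivAt_inv hk).comp (0 : Ix → ℝ) h1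
  have h4 := h3.mul h2
  simp only [Function.comp_apply, h0] at h4
  simp only [obs_gmul_gexp]
  refine ⟨_, h4, fun u => ?_⟩
  -- The rank-one terms of `ρᵀ` read off coordinates: `tr(q e_cᵀ M) = (M q)_c`.
  have ht (q : Fin 4 → ℝ) (c : Fin 4) (M : M4) :
      (vecMulVec q (Pi.single c 1) * M).trace = (M *ᵥ q) c := by
    rw [Matrix.trace_mul_comm, Matrix.mul_vecMulVec, Matrix.trace_vecMulVec]
    simp
  have hL : matSeLin (LinearMap.funLeft ℝ ℝ (Sum.inl : Fin 6 → Ix) u) =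
    matSe (fun i => u (Sum.inl i)) := rfl
  simp [rho, Matrix.sub_mul, Matrix.trace_sub, ht, hL, kappa, -mulVec_mulVec]
  ring

theorem isRiemannianGradient_obs (g : Fin 4 → ℝ) {G : Amb} (hG : G ∈ grp) (j : Fin 2)
    (h : kappa g G.1 ≠ 0) :
    IsRiemannianGradient (fun X => obs g X.1 j) G (tmap G (prSe (rho g G.1 j), 0)) := by
  refine ⟨⟨_, prSe_mem_se3 _, rfl⟩, ?_⟩
  obtain ⟨D, hD, hDu⟩ := hasFDerivAt_obs g G j h
  refine ⟨D, hD, fun u => ?_⟩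
  rw [hDu, metric_tmap hG]
  simp [matG, trace_transpose_mul_prSe]

theorem isLeftDifferential_obs {n : ℕ} (g : Fin n → Fin 4 → ℝ) (G : Amb)
    (h : ∀ k, kappa (g k) G.1 ≠ 0) :
    IsLeftDifferential (fun X => ∑ k, obs (g k) X.1) G (obsMatrix g G.1) := by
  unfold IsLeftDifferential
  rw [hasFDerivAt_pi']
  intro j
  choose D hD hDu using fun k => hasFDerivAt_obs (g k) G j (h k)
  have hs := HasFDerivAt.fun_sum (u := Finset.univ) fun k _ => hD k
  simp only [Finset.sum_apply]
  convert hs using 1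
  ext u
  simp [obsMatrix, hDu, mulVec, dotProduct, ← vecSe_prSe_dotProduct]

/-! ### Comparison of the filter steps -/

/-- The filter determines `J` only on `[a, b]`, so equality of the functions themselves is not
available. -/
theorem AlgorithmStep.congr_drift {m : ℕ} {f : Amb → Amb} {ad Φ : (Ix → ℝ) → M12}
    {J J' : ℝ → M12} {S : M12} {Q : Matrix (Fin m) (Fin m) ℝ} {r : Amb → Fin m → ℝ}
    {H : Matrix (Fin m) Ix ℝ} {a b : ℝ} {G₀ : Amb} {P₀ : M12} {G : ℝ → Amb} {P : ℝ → M12}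
    {G₁ : Amb} {P₁ : M12} (h : AlgorithmStep f ad Φ J S Q r H a b G₀ P₀ G P G₁ P₁)
    (hJ : ∀ t ∈ Icc a b, J t = J' t) :
    AlgorithmStep f ad Φ J' S Q r H a b G₀ P₀ G P G₁ P₁ :=
  { h with cov_ode := fun t ht => hJ t ht ▸ h.cov_ode t ht }

/-- One filter step of the model is one step of the algorithm with the explicit expressions. -/
theorem lieEKFStep_iff_algorithmStep {n : ℕ} (g : Fin n → Fin 4 → ℝ) (z : Fin n → Fin 2 → ℝ)
    (S : M12) (Q : Matrix (Fin 2) (Fin 2) ℝ) {a b : ℝ} (G₀ : Amb) (P₀ : M12)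
    (G : ℝ → Amb) (P : ℝ → M12) (G₁ : Amb) (P₁ : M12) (h : ∀ k, kappa (g k) (G b).1 ≠ 0) :
    LieEKFStep drift (fun X => ∑ k, obs (g k) X.1) (∑ k, z k) S Q a b G₀ P₀ G P G₁ P₁ ↔
      AlgorithmStep drift adGVec phiVec (fun t => driftMatrix S (G t)) S Q
        (fun X => ∑ k, (z k - obs (g k) X.1)) (obsMatrix g (G b).1) a b G₀ P₀ G P G₁ P₁ := by
  have had : adG = adGVec := funext adG_eq_adGVec
  have hphi : phiG = phiVec := funext phiG_eq_phiVec
  have hH := isLeftDifferential_obs g (G b) h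
  unfold LieEKFStep
  simp only [had, hphi, Finset.sum_sub_distrib]
  constructor
  · rintro ⟨J, H, hJ, hH', hstep⟩
    rw [hH'.unique hH] at hstep
    exact hstep.congr_drift fun t ht => (isDriftMatrix_iff S (G t) (J t)).1 (hJ t ht)
  · intro hstep
    exact ⟨_, _, fun t _ => (isDriftMatrix_iff S (G t) _).2 rfl, hH, hstep⟩

end EgoMotion

open EgoMotion
theorem mainTheorem6 (n : ℕ) (x : Fin n → Fin 2 → ℝ) (d : Fin n → ℝ → ℝ)
    (y : Fin n → ℝ → Fin 2 → ℝ)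
    (S : M12) (hS : S.PosDef)
    (N : ℕ) (τ : ℕ → ℝ) (hτ : StrictMono τ)
    (Q : ℕ → Matrix (Fin 2) (Fin 2) ℝ) (hQ : ∀ l, (Q l).PosDef) :
    -- `F`, the adjoint and the function `Φ` have the stated explicit forms, so that `J` is
    -- given by its explicit formula
    (∀ G ∈ grp, IsLeftDifferential (fun X => vecG (drift X)) G driftDiff) ∧
    (∀ u, adG u = adGVec u) ∧
    (∀ u, phiG u = phiVec u) ∧
    (∀ G ∈ grp, ∀ J, IsDriftMatrix drift S G J ↔ J = driftMatrix S G) ∧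
    -- the correction `C(S)` for diagonal `S`
    (∀ s : Ix → ℝ, S = diagonal s → corr adGVec S = corrDiag s) ∧
    -- the Riemannian gradients of the observation functions, and `H` as the left-trivialized
    -- differential of their sum
    (∀ (t : ℝ) (G : Amb), G ∈ grp →
      (∀ k (j : Fin 2), kappa (dataVec (x k) (d k t)) G.1 ≠ 0 →
        IsRiemannianGradient (fun X => obs (dataVec (x k) (d k t)) X.1 j) G
          (tmap G (prSe (rho (dataVec (x k) (d k t)) G.1 j), 0))) ∧
      ((∀ k, kappa (dataVec (x k) (d k t)) G.1 ≠ 0) →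
        IsLeftDifferential (fun X => ∑ k, obs (dataVec (x k) (d k t)) X.1) G
          (obsMatrix (fun k => dataVec (x k) (d k t)) G.1))) ∧
    -- the filter of the model is the algorithm with these expressions
    (∀ (G : ℕ → ℝ → Amb) (P : ℕ → ℝ → M12) (Gpost : ℕ → Amb) (Ppost : ℕ → M12),
      (∀ l < N, ∀ k,
        kappa (dataVec (x k) (d k (τ (l + 1)))) (G l (τ (l + 1))).1 ≠ 0) →
      ((∀ l < N,
          LieEKFStep drift
            (fun X => ∑ k, obs (dataVec (x k) (d k (τ (l + 1)))) X.1)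
            (∑ k, y k (τ (l + 1))) S (Q (l + 1)) (τ l) (τ (l + 1))
            (Gpost l) (Ppost l) (G l) (P l) (Gpost (l + 1)) (Ppost (l + 1))) ↔
        (∀ l < N,
          AlgorithmStep drift adGVec phiVec (fun t => driftMatrix S (G l t)) S (Q (l + 1))
            (fun X => ∑ k, (y k (τ (l + 1)) - obs (dataVec (x k) (d k (τ (l + 1)))) X.1))
            (obsMatrix (fun k => dataVec (x k) (d k (τ (l + 1)))) (G l (τ (l + 1))).1)
            (τ l) (τ (l + 1))
            (Gpost l) (Ppost l) (G l) (P l) (Gpost (l + 1)) (Ppost (l + 1))))) := by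
  refine ⟨fun G _ => isLeftDifferential_drift G, adG_eq_adGVec, phiG_eq_phiVec,
    fun G _ J => isDriftMatrix_iff S G J, fun s hs => hs ▸ corr_diagonal s,
    fun t G hG => ⟨fun k j h => isRiemannianGradient_obs _ hG j h,
      isLeftDifferential_obs _ G⟩, fun G P Gpost Ppost h => ?_⟩
  -- Both sides share the same trajectories and updates, so the steps are compared one at a time,
  -- without induction.
  exact forall₂_congr fun l hl => lieEKFStep_iff_algorithmStep _ _ S _ _ _ _ _ _ _ (h l hl)
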